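/- Let $\mathcal L$ be a countable signature extending the language $\mathcal L_{\mathrm{PA}}=\{0,S,+,\times\}$ of Peano arithmetic, and let $M$ be a countable $\mathcal L$-structure such that: - $M$ satisfies $\mathrm{PA}$ (with induction for $\mathcal L_{\mathrm{PA}}$-formulas); - $M$ satisfies the full collection scheme: for every $\mathcal L$-formula $\phi(x,y)$ with parameters from $M$ and every $a\in M$, if for every $x<a$ there is $y$ with $M\models\phi(x,y)$, then there is $b\in M$ such that for every $x<a$ there is $y<b$ with $M\models\phi(x,y)$; - $M$ is piecewise recursively saturated: every recursive set $p(v)$ of $\mathcal L$-formulas with finitely many parameters from $M$ in which only finitely many symbols of $\mathcal L$ occur, and which is finitely satisfiable in $M$, is realised in $M$. Then there is a proper $\mathcal L$-elementary extension $M'\succ M$ which is an end-extension (that is, $a<c$ for all $a\in M$ and $c\in M'\setminus M$), such that $M$ is a locally semiregular cut of $M'$: $M$ is an initial segment of $M'$ closed under $S$ and containing a nonstandard element, and for every nonstandard $a\in M$ and every function $f:[0,a]\to M'$ coded in $M'$ there exist a nonstandard $a'\le a$ and $b\in M$ with $$f[[0,a']]\cap M\subseteq[0,b].$$ -/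

import Mathlib

open scoped FirstOrder

universe u v w

namespace Arith

/-- Function symbols of the language of Peano arithmetic: `0`, `S`, `+`, `×`. -/
inductive LPAFunc : ℕ → Type
  | zero : LPAFunc 0
  | succ : LPAFunc 1
  | add : LPAFunc 2
  | mul : LPAFunc 2

/-- The language of Peano arithmetic. -/
def LPA : FirstOrder.Language.{0, 0} := ⟨LPAFunc, fun _ => Empty⟩

section Arithmetic

variable {M : Type*} [LPA.Structure M]

/-- The interpretation of `0`. -/
def zero : M :=
  FirstOrder.Language.Structure.funMap (L := LPA) (M := M) LPAFunc.zero ![]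

/-- The interpretation of the successor function. -/
def succ (x : M) : M :=
  FirstOrder.Language.Structure.funMap (L := LPA) (M := M) LPAFunc.succ ![x]

/-- The interpretation of addition. -/
def add (x y : M) : M :=
  FirstOrder.Language.Structure.funMap (L := LPA) (M := M) LPAFunc.add ![x, y]

/-- The interpretation of multiplication. -/
def mul (x y : M) : M :=
  FirstOrder.Language.Structure.funMap (L := LPA) (M := M) LPAFunc.mul ![x, y]

/-- The usual arithmetical definition of `x ≤ y`. -/
def Le (x y : M) : Prop := ∃ z : M, add x z = y

/-- The usual arithmetical definition of `x < y`. -/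
def Lt (x y : M) : Prop := ∃ z : M, add x (succ z) = y

/-- `x` is standard: it is the value of a numeral `S ⋯ S 0`. -/
def IsStandard (x : M) : Prop := ∃ n : ℕ, succ^[n] (zero : M) = x

/-- `I` is a cut: an initial segment closed under successor. -/
def IsCut (I : Set M) : Prop :=
  (∀ a ∈ I, ∀ b : M, Le b a → b ∈ I) ∧ ∀ a ∈ I, succ a ∈ I

/-- The function `f : [0,a] → M` is coded in `M` (by Gödel's `β`-function): there are `c, d ∈ M`
such that `f x` is the remainder of `c` modulo `1 + (x + 1) d` for all `x ≤ a`. -/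
def IsCoded {a : M} (f : {x : M // Le x a} → M) : Prop :=
  ∃ c d : M, ∀ x : {x : M // Le x a},
    Lt (f x) (succ (mul (succ x.1) d)) ∧
      ∃ q : M, c = add (mul q (succ (mul (succ x.1) d))) (f x)

/-- `I` is a locally semiregular cut of `M`: it is a nonstandard cut, and every coded function
`f : [0,a] → M` with `a ∈ I` nonstandard can be restricted to `[0,a']` with `a'` nonstandard so
that those of its values that lie in `I` are bounded in `I`. -/
def IsLocallySemiregular (I : Set M) : Prop :=
  IsCut I ∧ (∃ a ∈ I, ¬ IsStandard a) ∧
    ∀ a ∈ I, ¬ IsStandard a → ∀ f : {x : M // Le x a} → M, IsCoded f →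
      ∃ a' : M, Le a' a ∧ ¬ IsStandard a' ∧
        ∃ b ∈ I, ∀ x : {x : M // Le x a}, Le x.1 a' → f x ∈ I → Le (f x) b

end Arithmetic

/-- `M` is a model of Peano arithmetic. In the induction scheme, variable `0` of `φ` is the
induction variable and the other ones are parameters. -/
structure IsModelPA (M : Type*) [LPA.Structure M] : Prop where
  succ_ne_zero : ∀ x : M, succ x ≠ zero
  succ_inj : ∀ x y : M, succ x = succ y → x = y
  add_zero : ∀ x : M, add x zero = x
  add_succ : ∀ x y : M, add x (succ y) = succ (add x y)
  mul_zero : ∀ x : M, mul x zero = zero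
  mul_succ : ∀ x y : M, mul x (succ y) = add (mul x y) x
  induction : ∀ (m : ℕ) (φ : LPA.Formula (Fin (m + 1))) (p : Fin m → M),
    φ.Realize (Fin.cons zero p : Fin (m + 1) → M) →
    (∀ x : M, φ.Realize (Fin.cons x p : Fin (m + 1) → M) →
      φ.Realize (Fin.cons (succ x) p : Fin (m + 1) → M)) →
    ∀ x : M, φ.Realize (Fin.cons x p : Fin (m + 1) → M)

/-- `M` satisfies the collection scheme for all `L`-formulas `φ(x, y, p)` with parameters `p`. -/
def SatisfiesCollection (L : FirstOrder.Language) (M : Type*) [LPA.Structure M] [L.Structure M] : Prop :=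
  ∀ (m : ℕ) (φ : L.Formula (Fin (m + 2))) (p : Fin m → M) (a : M),
    (∀ x : M, Lt x a → ∃ y : M,
      φ.Realize (Fin.cons x (Fin.cons y p : Fin (m + 1) → M) : Fin (m + 2) → M)) →
    ∃ b : M, ∀ x : M, Lt x a → ∃ y : M, Lt y b ∧
      φ.Realize (Fin.cons x (Fin.cons y p : Fin (m + 1) → M) : Fin (m + 2) → M)

section Recursive

variable {L : FirstOrder.Language}

/-- The symbols of `L` that occur in a term. -/
def termSymbols {α : Type*} : L.Term α → Set L.Symbols
  | .var _ => ∅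
  | .func f ts => {Sum.inl ⟨_, f⟩} ∪ ⋃ i, termSymbols (ts i)

/-- The symbols of `L` that occur in a formula. -/
def formulaSymbols {α : Type*} : {n : ℕ} → L.BoundedFormula α n → Set L.Symbols
  | _, .falsum => ∅
  | _, .equal t₁ t₂ => termSymbols t₁ ∪ termSymbols t₂
  | _, .rel R ts => {Sum.inr ⟨_, R⟩} ∪ ⋃ i, termSymbols (ts i)
  | _, .imp φ ψ => formulaSymbols φ ∪ formulaSymbols ψ
  | _, .all φ => formulaSymbols φ

/-- The Gödel number of a term, given a numbering `e` of the symbols. -/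
def termCode (e : L.Symbols → ℕ) {k n : ℕ} : L.Term (Fin k ⊕ Fin n) → ℕ
  | .var (.inl i) => Nat.pair 0 i
  | .var (.inr i) => Nat.pair 1 i
  | .func f ts =>
      Nat.pair 2 (Nat.pair (e (Sum.inl ⟨_, f⟩))
        (Encodable.encode (List.ofFn fun i => termCode e (ts i))))

/-- The Gödel number of a formula, given a numbering `e` of the symbols. -/
def formulaCode (e : L.Symbols → ℕ) {k : ℕ} : {n : ℕ} → L.BoundedFormula (Fin k) n → ℕ
  | _, .falsum => Nat.pair 0 0
  | _, .equal t₁ t₂ => Nat.pair 1 (Nat.pair (termCode e t₁) (termCode e t₂))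
  | _, .rel R ts =>
      Nat.pair 2 (Nat.pair (e (Sum.inr ⟨_, R⟩))
        (Encodable.encode (List.ofFn fun i => termCode e (ts i))))
  | _, .imp φ ψ => Nat.pair 3 (Nat.pair (formulaCode e φ) (formulaCode e ψ))
  | _, .all φ => Nat.pair 4 (formulaCode e φ)

/-- `p` is a recursive set of formulas in which only finitely many symbols of `L` occur. For such
`p` recursiveness does not depend on the numbering of the symbols that occur. -/
def IsFiniteSymbolRecursive {k : ℕ} (p : Set (L.Formula (Fin k))) : Prop :=
  (⋃ φ ∈ p, formulaSymbols φ).Finite ∧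
    ∃ e : L.Symbols → ℕ, Set.InjOn e (⋃ φ ∈ p, formulaSymbols φ) ∧
      ComputablePred fun c : ℕ => ∃ φ ∈ p, formulaCode e φ = c

/-- `M` is piecewise recursively saturated: every recursive type `p(v, a)` over `M`, with finitely
many parameters `a` and finitely many symbols, is realised in `M`. Variable `0` of the formulas
is `v`. -/
def IsPiecewiseRecursivelySaturated (L : FirstOrder.Language) (M : Type*) [L.Structure M] : Prop :=
  ∀ (m : ℕ) (p : Set (L.Formula (Fin (m + 1)))) (a : Fin m → M),
    IsFiniteSymbolRecursive p →
    (∀ F : Finset (L.Formula (Fin (m + 1))), ↑F ⊆ p →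
      ∃ x : M, ∀ φ ∈ F, φ.Realize (Fin.cons x a : Fin (m + 1) → M)) →
    ∃ x : M, ∀ φ ∈ p, φ.Realize (Fin.cons x a : Fin (m + 1) → M)

end Recursive

/-- The embedding `j : M → N` makes `N` a proper end-extension of `M`. -/
def IsProperEndExtension {M N : Type*} [LPA.Structure N] (j : M → N) : Prop :=
  Set.range j ≠ Set.univ ∧ ∀ c : N, c ∉ Set.range j → ∀ a : M, Lt (j a) c

end Arith

/-!
`M'` is built by forcing over `M`. A condition is a definable decreasing family, indexed by `M`, of
nonempty sets of assignments of elements of `M` to countably many variables: it promises that the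
assignment lies in every set of the family. By countability there is an ultrafilter of assignments
that meets all the dense sets of conditions below. It contains witnesses for all definable
relations, so by Łoś's theorem the variables name an elementary substructure `M'` of the
ultrapower of `M`.

* By collection, if no value `m ≤ a` of a variable is compatible with a condition, then one member
  of the family already excludes them all. Hence every element of `M'` below `a` is in `M`.
* Given a definable partial function and an argument, a condition can be strengthened so that the
  value is either bounded in `M` or above all of `M`. Iterating, this can be achieved for the
  finitely many arguments below a standard `a'`, with one common bound. That a condition is
  compatible with such a bound on `[0, a']` is a definable property of `a'`, and by saturation the
  set of standard elements is not definable, so that it holds for some nonstandard `a'`.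
-/

namespace Arith

section Definability

open FirstOrder Language Set

variable {K : FirstOrder.Language.{u, v}} {M : Type w} [K.Structure M] {α β : Type*}

theorem exists_finset_definable {A : Set M} {s : Set (α → M)} (hs : A.Definable K s) :
    ∃ (S : Finset α) (t : Set (S → M)), A.Definable K t ∧ s = (fun v i => v i) ⁻¹' t := by
  classical
  obtain ⟨φ, rfl⟩ := hs
  exact ⟨φ.freeVarFinset, {v | (φ.restrictFreeVar id).Realize v default}, ⟨_, rfl⟩,
    Set.ext fun v => (BoundedFormula.realize_restrictFreeVar (f := id) v fun _ => rfl).symm⟩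

@[fun_prop]
theorem definableFun_const_univ (a : M) :
    (univ : Set M).DefinableFun K fun _ : α → M => a :=
  definableFun_const K α (mem_univ a)

variable (K) in
/-- The predicate `P` on assignments `α → M` is definable with parameters from `M`. This is
`Set.Definable` stated for predicates, so that definitions can be assembled connective by
connective. -/
def DefinablePred (P : (α → M) → Prop) : Prop :=
  (univ : Set M).Definable K {v | P v}

theorem definablePred_realize (φ : K.Formula α) :
    DefinablePred K fun v : α → M => φ.Realize v :=
  (empty_definable_iff.2 ⟨φ, rfl⟩).mono (empty_subset univ)

namespace DefinablePred

variable {P Q : (α → M) → Prop}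

theorem eq {f g : (α → M) → M} (hf : (univ : Set M).DefinableFun K f)
    (hg : (univ : Set M).DefinableFun K g) : DefinablePred K fun v => f v = g v :=
  hf.ofPred_eq hg

theorem not (hP : DefinablePred K P) : DefinablePred K fun v => ¬ P v :=
  Definable.compl hP

theorem and (hP : DefinablePred K P) (hQ : DefinablePred K Q) :
    DefinablePred K fun v => P v ∧ Q v :=
  Definable.inter hP hQ

theorem or (hP : DefinablePred K P) (hQ : DefinablePred K Q) :
    DefinablePred K fun v => P v ∨ Q v :=
  Definable.union hP hQ

theorem imp (hP : DefinablePred K P) (hQ : DefinablePred K Q) :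
    DefinablePred K fun v => P v → Q v := by
  simpa only [imp_iff_not_or] using hP.not.or hQ

theorem reindex (hP : DefinablePred K P) (f : α → β) :
    DefinablePred K fun v : β → M => P fun i => v (f i) :=
  Definable.preimage_comp f hP

theorem subst₂ {R : M → M → Prop} (hR : DefinablePred K fun v : Fin 2 → M => R (v 0) (v 1))
    {f g : (α → M) → M} (hf : (univ : Set M).DefinableFun K f)
    (hg : (univ : Set M).DefinableFun K g) : DefinablePred K fun v => R (f v) (g v) :=
  Definable.preimage_map (F := fun v => ![f v, g v]) (by
    intro i
    fin_cases i
    exacts [hf, hg]) hR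

theorem exists_block [Nonempty M] {P : (α → M) → (β → M) → Prop}
    (hP : DefinablePred K fun w : α ⊕ β → M => P (fun i => w (.inl i)) fun i => w (.inr i)) :
    DefinablePred K fun v => ∃ s, P v s := by
  classical
  obtain ⟨S, t, ht, hPt⟩ := exists_finset_definable hP
  let incl : S → α ⊕ {b // b ∈ S.toRight} := fun i =>
    Sum.casesOn (motive := fun i => i ∈ S → α ⊕ {b // b ∈ S.toRight}) i.1
      (fun a _ => .inl a) (fun b hb => .inr ⟨b, Finset.mem_toRight.2 hb⟩) i.2
  have key (v : α → M) (s : β → M) :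
      P v s ↔ (fun i => Sum.elim v (fun b : {b // b ∈ S.toRight} => s b) (incl i)) ∈ t := by
    refine (Set.ext_iff.1 hPt (Sum.elim v s)).trans (iff_of_eq (congrArg (· ∈ t) ?_))
    funext ⟨i, hi⟩
    cases i <;> rfl
  have hex := Definable.exists_of_finite (β := {b // b ∈ S.toRight}) (ht.preimage_comp incl)
  refine (congrArg (Definable univ K) (Set.ext fun v => ?_)).mpr hex
  constructor
  · rintro ⟨s, hs⟩
    exact ⟨fun b => s b, (key v s).1 hs⟩
  · rintro ⟨s, hs⟩
    refine ⟨Function.extend Subtype.val s fun _ => Classical.arbitrary M, (key v _).2 ?_⟩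
    simpa only [Subtype.val_injective.extend_apply] using! hs

theorem exists_var [Nonempty M] {P : (α → M) → M → Prop}
    (hP : DefinablePred K fun w : Option α → M => P (fun i => w (some i)) (w none)) :
    DefinablePred K fun v => ∃ y, P v y := by
  have h := exists_block (P := fun v (s : Unit → M) => P v (s ()))
    (hP.reindex (β := α ⊕ Unit) fun i => i.elim (.inr ()) .inl)
  simpa only [(Equiv.funUnique Unit M).exists_congr_left] using! h

theorem forall_var [Nonempty M] {P : (α → M) → M → Prop}
    (hP : DefinablePred K fun w : Option α → M => P (fun i => w (some i)) (w none)) :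
    DefinablePred K fun v => ∀ y, P v y := by
  simpa only [not_exists, not_not] using (exists_var (P := fun v y => ¬ P v y) hP.not).not

theorem specialize [Nonempty M] {P : (α → M) → M → Prop}
    (hP : DefinablePred K fun w : Option α → M => P (fun i => w (some i)) (w none)) (a : M) :
    DefinablePred K fun v => P v a := by
  simpa only [exists_eq_left] using
    exists_var (P := fun v y => y = a ∧ P v y) (.and (.eq (by fun_prop) (by fun_prop)) hP)

theorem exists_finset_support (hP : DefinablePred K P) :
    ∃ S : Finset α, ∀ v v' : α → M, (∀ i ∈ S, v i = v' i) → (P v ↔ P v') := by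
  obtain ⟨S, t, -, ht⟩ := exists_finset_definable hP
  refine ⟨S, fun v v' h => (Set.ext_iff.1 ht v).trans (Iff.trans ?_ (Set.ext_iff.1 ht v').symm)⟩
  exact iff_of_eq (congrArg (· ∈ t) (funext fun i => h i i.2))

theorem exists_formula_sum (hP : DefinablePred K P) :
    ∃ (m : ℕ) (φ : K.Formula (Fin m ⊕ α)) (p : Fin m → M),
      ∀ v, φ.Realize (Sum.elim p v) ↔ P v := by
  obtain ⟨A, -, hA⟩ := definable_iff_finitely_definable.1 hP
  obtain ⟨φ, hφ⟩ := definable_iff_exists_formula_sum.1 hA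
  refine ⟨_, φ.relabel (Sum.map A.equivFin id), fun i => A.equivFin.symm i, fun v => ?_⟩
  rw [Formula.realize_relabel, Sum.elim_comp_map]
  refine Iff.trans (iff_of_eq (congrArg φ.Realize (congrArg₂ Sum.elim ?_ rfl)))
    (Set.ext_iff.1 hφ v).symm
  funext i
  exact congrArg Subtype.val (A.equivFin.symm_apply_apply i)

theorem exists_formula {P : M → Prop} (hP : DefinablePred K fun v : Fin 1 → M => P (v 0)) :
    ∃ (m : ℕ) (φ : K.Formula (Fin (m + 1))) (p : Fin m → M),
      ∀ x, φ.Realize (Fin.cons x p : Fin (m + 1) → M) ↔ P x := by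
  obtain ⟨m, φ, p, hφ⟩ := hP.exists_formula_sum
  refine ⟨m, φ.relabel (Sum.elim Fin.succ fun _ => 0), p, fun x => ?_⟩
  rw [Formula.realize_relabel, ← hφ fun _ => x, Sum.comp_elim]
  exact Iff.rfl

theorem exists_formula₂ {R : M → M → Prop}
    (hR : DefinablePred K fun v : Fin 2 → M => R (v 0) (v 1)) :
    ∃ (m : ℕ) (φ : K.Formula (Fin (m + 2))) (p : Fin m → M), ∀ x y,
      φ.Realize (Fin.cons x (Fin.cons y p : Fin (m + 1) → M) : Fin (m + 2) → M) ↔ R x y := by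
  obtain ⟨m, φ, p, hφ⟩ := hR.exists_formula_sum
  refine ⟨m, φ.relabel (Sum.elim (fun i => i.succ.succ) ![0, 1]), p, fun x y => ?_⟩
  rw [Formula.realize_relabel, ← show _ ↔ R x y from hφ ![x, y], Sum.comp_elim]
  refine iff_of_eq (congrArg φ.Realize (congrArg₂ Sum.elim rfl ?_))
  funext i
  fin_cases i <;> rfl

end DefinablePred

theorem countable_definablePred [Countable α] [Countable M] [Countable K.Symbols] :
    Countable {P : (α → M) → Prop // DefinablePred K P} := by
  choose φ hφ using fun P : {P : (α → M) → Prop // DefinablePred K P} => P.2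
  refine Function.Injective.countable (f := φ) fun P Q h =>
    Subtype.ext (funext fun v => propext ?_)
  exact (Set.ext_iff.1 (hφ P) v).trans (h ▸ (Set.ext_iff.1 (hφ Q) v).symm)

theorem countable_definableRel [Countable α] [Countable M] [Countable K.Symbols] :
    Countable {R : (α → M) → M → Prop //
      DefinablePred K fun v : Option α → M => R (fun i => v (some i)) (v none)} :=
  have := countable_definablePred (K := K) (M := M) (α := Option α)
  Function.Injective.countable
    (f := fun R => (⟨_, R.2⟩ : {P : (Option α → M) → Prop // DefinablePred K P}))
    fun _ _ h => Subtype.ext (funext₂ fun s y =>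
      congrFun (congrArg Subtype.val h) fun o => o.elim y s)

theorem countable_definableRel₂ [Countable α] [Countable M] [Countable K.Symbols] :
    Countable {R : (α → M) → M → M → Prop // DefinablePred K fun v : Option (Option α) → M =>
      R (fun i => v (some (some i))) (v (some none)) (v none)} :=
  have := countable_definablePred (K := K) (M := M) (α := Option (Option α))
  Function.Injective.countable
    (f := fun R => (⟨_, R.2⟩ : {P : (Option (Option α) → M) → Prop // DefinablePred K P}))
    fun _ _ h => Subtype.ext (funext₃ fun s x y =>
      congrFun (congrArg Subtype.val h) fun o => o.elim y fun o => o.elim x s)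

end Definability

section Terms

open FirstOrder Language Set

variable {α M : Type*} [LPA.Structure M]

instance nonempty_of_structure : Nonempty M := ⟨zero⟩

instance : Add (LPA.Term α) := ⟨Functions.apply₂ LPAFunc.add⟩

instance : Mul (LPA.Term α) := ⟨Functions.apply₂ LPAFunc.mul⟩

/-- The term `S t`. -/
def succTerm (t : LPA.Term α) : LPA.Term α := Functions.apply₁ LPAFunc.succ t

@[simp]
theorem realize_add (t t' : LPA.Term α) (v : α → M) :
    (t + t').realize v = add (t.realize v) (t'.realize v) :=
  Term.realize_functions_apply₂

@[simp]
theorem realize_mul (t t' : LPA.Term α) (v : α → M) :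
    (t * t').realize v = mul (t.realize v) (t'.realize v) :=
  Term.realize_functions_apply₂

@[simp]
theorem realize_succTerm (t : LPA.Term α) (v : α → M) :
    (succTerm t).realize v = succ (t.realize v) :=
  Term.realize_functions_apply₁

variable {A : Set M} {f g : (α → M) → M}

@[fun_prop]
theorem definableFun_succ (hf : A.DefinableFun LPA f) :
    A.DefinableFun LPA fun v => succ (f v) :=
  DefinableFun.comp (g := fun v => ![f v]) (by intro i; fin_cases i; exact hf)
    (.of_empty (.fun_symbol (L := LPA) LPAFunc.succ))

@[fun_prop]
theorem definableFun_add (hf : A.DefinableFun LPA f) (hg : A.DefinableFun LPA g) :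
    A.DefinableFun LPA fun v => add (f v) (g v) :=
  DefinableFun.comp (g := fun v => ![f v, g v]) (by intro i; fin_cases i; exacts [hf, hg])
    (.of_empty (.fun_symbol (L := LPA) LPAFunc.add))

@[fun_prop]
theorem definableFun_mul (hf : A.DefinableFun LPA f) (hg : A.DefinableFun LPA g) :
    A.DefinableFun LPA fun v => mul (f v) (g v) :=
  DefinableFun.comp (g := fun v => ![f v, g v]) (by intro i; fin_cases i; exacts [hf, hg])
    (.of_empty (.fun_symbol (L := LPA) LPAFunc.mul))

end Terms

section Formulas

open FirstOrder Language Set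

variable {M : Type*} [LPA.Structure M]

/-- `y` is the value at `x` of the function with `β`-code `(c, d)`. -/
def Beta (c d x y : M) : Prop :=
  Lt y (succ (mul (succ x) d)) ∧ ∃ q : M, c = add (mul q (succ (mul (succ x) d))) y

/-- The formula `x₀ ≤ x₁`. -/
def leFormula : LPA.Formula (Fin 2) :=
  ∃' ((.var (.inl 0) + .var (.inr 0)) =' .var (.inl 1))

/-- The formula `x₀ < x₁`. -/
def ltFormula : LPA.Formula (Fin 2) :=
  ∃' ((.var (.inl 0) + succTerm (.var (.inr 0))) =' .var (.inl 1))

/-- The formula `Beta x₀ x₁ x₂ x₃`. -/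
def betaFormula : LPA.Formula (Fin 4) :=
  letI t : LPA.Term (Fin 4 ⊕ Fin 1) :=
    succTerm (succTerm (.var (.inl 2)) * .var (.inl 1))
  ∃' ((.var (.inl 3) + succTerm (.var (.inr 0))) =' t) ⊓
    ∃' (.var (.inl 0) =' (.var (.inr 0) * t + .var (.inl 3)))

theorem realize_leFormula (v : Fin 2 → M) : leFormula.Realize v ↔ Le (v 0) (v 1) := by
  simp [leFormula, Formula.Realize, Le, Fin.snoc]

theorem realize_ltFormula (v : Fin 2 → M) : ltFormula.Realize v ↔ Lt (v 0) (v 1) := by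
  simp [ltFormula, Formula.Realize, Lt, Fin.snoc]

theorem realize_betaFormula (v : Fin 4 → M) :
    betaFormula.Realize v ↔ Beta (v 0) (v 1) (v 2) (v 3) := by
  simp [betaFormula, Formula.Realize, Beta, Lt, Fin.snoc]

end Formulas

namespace IsModelPA

open Set

variable {M : Type*} [LPA.Structure M] (hM : IsModelPA M)

include hM

theorem induction_of_definable {P : M → Prop}
    (hP : DefinablePred LPA fun v : Fin 1 → M => P (v 0)) (hzero : P zero)
    (hsucc : ∀ x, P x → P (succ x)) (x : M) : P x := by
  obtain ⟨m, φ, p, hφ⟩ := hP.exists_formula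
  exact (hφ x).1 (hM.induction m φ p ((hφ _).2 hzero)
    (fun y hy => (hφ _).2 (hsucc y ((hφ y).1 hy))) x)

theorem induction_eq {f g : M → M}
    (hf : (univ : Set M).DefinableFun LPA fun v : Fin 1 → M => f (v 0))
    (hg : (univ : Set M).DefinableFun LPA fun v : Fin 1 → M => g (v 0))
    (hzero : f zero = g zero) (hsucc : ∀ x, f x = g x → f (succ x) = g (succ x)) (x : M) :
    f x = g x :=
  hM.induction_of_definable (P := fun x => f x = g x) (.eq hf hg) hzero hsucc x

theorem zero_add (x : M) : add zero x = x :=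
  hM.induction_eq (f := add zero) (g := id) (by fun_prop) (by fun_prop) (hM.add_zero _)
    (fun x hx => by rw [hM.add_succ, hx, id, id]) x

theorem succ_add (x y : M) : add (succ x) y = succ (add x y) :=
  hM.induction_eq (f := add (succ x)) (g := fun y => succ (add x y)) (by fun_prop) (by fun_prop)
    (by rw [hM.add_zero, hM.add_zero]) (fun y hy => by rw [hM.add_succ, hy, hM.add_succ]) y

theorem add_comm (x y : M) : add x y = add y x :=
  hM.induction_eq (f := add x) (g := fun y => add y x) (by fun_prop) (by fun_prop)
    (by rw [hM.add_zero, hM.zero_add]) (fun y hy => by rw [hM.add_succ, hy, hM.succ_add]) y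

theorem add_assoc (x y z : M) : add (add x y) z = add x (add y z) :=
  hM.induction_eq (f := add (add x y)) (g := fun z => add x (add y z)) (by fun_prop)
    (by fun_prop) (by rw [hM.add_zero, hM.add_zero])
    (fun z hz => by rw [hM.add_succ, hz, hM.add_succ, hM.add_succ]) z

theorem add_left_cancel {x y z : M} : add z x = add z y → x = y := by
  refine hM.induction_of_definable (P := fun z => add z x = add z y → x = y)
    (.imp (.eq (by fun_prop) (by fun_prop)) (.eq (by fun_prop) (by fun_prop))) ?_
    (fun z hz h => hz (hM.succ_inj _ _ ?_)) z
  · rw [hM.zero_add, hM.zero_add]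
    exact id
  · rwa [hM.succ_add, hM.succ_add] at h

theorem succ_mul (x y : M) : mul (succ x) y = add (mul x y) y :=
  hM.induction_eq (f := mul (succ x)) (g := fun y => add (mul x y) y) (by fun_prop)
    (by fun_prop) (by rw [hM.mul_zero, hM.mul_zero, hM.add_zero])
    (fun y hy => by
      rw [hM.mul_succ, hM.mul_succ, hy, hM.add_succ, hM.add_succ, hM.add_assoc, hM.add_assoc,
        hM.add_comm y x]) y

theorem add_mul (x y z : M) : mul (add x y) z = add (mul x z) (mul y z) :=
  hM.induction_eq (f := mul (add x y)) (g := fun z => add (mul x z) (mul y z)) (by fun_prop)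
    (by fun_prop) (by rw [hM.mul_zero, hM.mul_zero, hM.mul_zero, hM.add_zero])
    (fun z hz => by
      rw [hM.mul_succ, hM.mul_succ, hM.mul_succ, hz, hM.add_assoc, hM.add_assoc,
        ← hM.add_assoc (mul y z), hM.add_comm (mul y z) x, hM.add_assoc x]) z

theorem eq_zero_or_exists_succ (x : M) : x = zero ∨ ∃ y, x = succ y :=
  hM.induction_of_definable (P := fun x => x = zero ∨ ∃ y, x = succ y)
    (.or (.eq (by fun_prop) (by fun_prop)) (.exists_var (.eq (by fun_prop) (by fun_prop))))
    (.inl rfl) (fun x _ => .inr ⟨x, rfl⟩) x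

theorem le_refl (x : M) : Le x x := ⟨zero, hM.add_zero x⟩

theorem le_total (x y : M) : Le x y ∨ Le y x := by
  refine hM.induction_of_definable (P := fun x => Le x y ∨ Le y x)
    (.or (.exists_var (.eq (by fun_prop) (by fun_prop)))
      (.exists_var (.eq (by fun_prop) (by fun_prop)))) (.inl ⟨y, hM.zero_add y⟩) ?_ x
  rintro x (⟨z, rfl⟩ | ⟨z, rfl⟩)
  · rcases hM.eq_zero_or_exists_succ z with rfl | ⟨z, rfl⟩
    · exact .inr ⟨succ zero, by rw [hM.add_succ, hM.add_zero, hM.add_zero]⟩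
    · exact .inl ⟨z, by rw [hM.succ_add, hM.add_succ]⟩
  · exact .inr ⟨succ z, hM.add_succ y z⟩

theorem lt_irrefl (x : M) : ¬ Lt x x := fun ⟨z, hz⟩ =>
  hM.succ_ne_zero z (hM.add_left_cancel (hz.trans (hM.add_zero x).symm))

theorem le_trans {x y z : M} : Le x y → Le y z → Le x z := by
  rintro ⟨a, rfl⟩ ⟨b, rfl⟩
  exact ⟨add a b, (hM.add_assoc _ _ _).symm⟩

theorem lt_of_lt_of_le {x y z : M} : Lt x y → Le y z → Lt x z := by
  rintro ⟨a, rfl⟩ ⟨b, rfl⟩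
  exact ⟨add a b, by rw [hM.add_assoc, hM.succ_add]⟩

theorem eq_or_lt_of_le {x y : M} : Le x y → x = y ∨ Lt x y := by
  rintro ⟨z, rfl⟩
  rcases hM.eq_zero_or_exists_succ z with rfl | ⟨z, rfl⟩
  exacts [.inl (hM.add_zero x).symm, .inr ⟨z, rfl⟩]

theorem lt_iff_le_not_ge (x y : M) : Lt x y ↔ Le x y ∧ ¬ Le y x := by
  constructor
  · exact fun h => ⟨h.imp' succ fun _ => id, fun hyx => hM.lt_irrefl x (hM.lt_of_lt_of_le h hyx)⟩
  · rintro ⟨hxy, hyx⟩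
    refine (hM.eq_or_lt_of_le hxy).resolve_left ?_
    rintro rfl
    exact hyx hxy

theorem le_antisymm {x y : M} (hxy : Le x y) (hyx : Le y x) : x = y :=
  (hM.eq_or_lt_of_le hxy).resolve_right fun h => hM.lt_irrefl x (hM.lt_of_lt_of_le h hyx)

/-- The usual ordering of a model of arithmetic; its `≤` and `<` are `Le` and `Lt`. -/
noncomputable abbrev linearOrder : LinearOrder M where
  le := Le
  lt := Lt
  le_refl := hM.le_refl
  le_trans _ _ _ := hM.le_trans
  lt_iff_le_not_ge := hM.lt_iff_le_not_ge
  le_antisymm _ _ := hM.le_antisymm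
  le_total := hM.le_total
  toDecidableLE := Classical.decRel _

theorem lt_succ_iff {x y : M} : Lt x (succ y) ↔ Le x y := by
  constructor
  · rintro ⟨z, hz⟩
    exact ⟨z, hM.succ_inj _ _ ((hM.add_succ x z).symm.trans hz)⟩
  · rintro ⟨z, rfl⟩
    exact ⟨z, hM.add_succ x z⟩

theorem le_zero_iff {x : M} : Le x zero ↔ x = zero := by
  constructor
  · exact fun h => hM.le_antisymm h ⟨x, hM.zero_add x⟩
  · rintro rfl
    exact hM.le_refl _

theorem le_succ_iff {x y : M} : Le x (succ y) ↔ x = succ y ∨ Le x y := by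
  refine ⟨fun h => (hM.eq_or_lt_of_le h).imp_right hM.lt_succ_iff.1, ?_⟩
  rintro (rfl | h)
  exacts [hM.le_refl _, hM.le_trans h ⟨succ zero, by rw [hM.add_succ, hM.add_zero]⟩]

theorem beta_unique {c d x y y' : M} (h : Beta c d x y) (h' : Beta c d x y') : y = y' := by
  let _ := hM.linearOrder
  -- two quotients `q < q'` would make the remainder `y` at least the modulus `t`
  have key {t q q' y y' : M} (hy : y < t) (hqq' : q < q')
      (h : add (mul q t) y = add (mul q' t) y') : False := by
    obtain ⟨z, rfl⟩ := hqq'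
    rw [hM.add_mul, hM.add_assoc, hM.succ_mul] at h
    refine (hy.trans_le ⟨add (mul z t) y', ?_⟩).false
    rw [hM.add_left_cancel h, ← hM.add_assoc, hM.add_comm t]
  obtain ⟨hy, q, rfl⟩ := h
  obtain ⟨hy', q', h'⟩ := h'
  rcases lt_trichotomy q q' with hq | rfl | hq
  · exact (key hy hq h').elim
  · exact hM.add_left_cancel h'
  · exact (key hy' hq h'.symm).elim

theorem finite_le_iterate_succ_zero (n : ℕ) : {x : M | Le x (succ^[n] zero)}.Finite := by
  induction n with
  | zero =>
    simp only [Function.iterate_zero_apply, hM.le_zero_iff, ofPred_eq_eq_singleton,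
      finite_singleton]
  | succ n ih =>
    simp only [Function.iterate_succ_apply', hM.le_succ_iff]
    exact (finite_singleton _).union ih

theorem injective_iterate_succ_zero : Function.Injective fun n => succ^[n] (zero : M) := by
  let _ := hM.linearOrder
  refine StrictMono.injective (strictMono_nat_of_lt_succ fun n => ?_)
  rw [Function.iterate_succ_apply']
  exact hM.lt_succ_iff.2 (hM.le_refl _)

theorem iterate_succ_zero_le_of_not_isStandard {x : M} (hx : ¬ IsStandard x) (n : ℕ) :
    Le (succ^[n] zero) x := by
  induction n with
  | zero => exact ⟨x, hM.zero_add x⟩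
  | succ n ih =>
    rw [Function.iterate_succ_apply']
    refine (hM.le_total _ _).resolve_right fun h => ?_
    rcases hM.le_succ_iff.1 h with h | h
    · exact hx ⟨n + 1, (Function.iterate_succ_apply' _ _ _).trans h.symm⟩
    · exact hx ⟨n, hM.le_antisymm ih h⟩

theorem isStandard_iff_finite {x : M} : IsStandard x ↔ {y | Le y x}.Finite := by
  constructor
  · rintro ⟨n, rfl⟩
    exact hM.finite_le_iterate_succ_zero n
  · contrapose
    exact fun hx => infinite_of_injective_forall_mem hM.injective_iterate_succ_zero
      (hM.iterate_succ_zero_le_of_not_isStandard hx)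

end IsModelPA

section Saturation

open FirstOrder Language Set

variable {K : FirstOrder.Language.{u, v}} {α : Type*}

theorem finite_termSymbols (t : K.Term α) : (termSymbols t).Finite := by
  induction t with
  | var => exact finite_empty
  | func f ts ih => exact (finite_singleton _).union (finite_iUnion ih)

theorem finite_formulaSymbols {n : ℕ} (φ : K.BoundedFormula α n) :
    (formulaSymbols φ).Finite := by
  induction φ with
  | falsum => exact finite_empty
  | equal t₁ t₂ => exact (finite_termSymbols t₁).union (finite_termSymbols t₂)
  | rel R ts => exact (finite_singleton _).union (finite_iUnion fun i => finite_termSymbols (ts i))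
  | imp φ ψ ih ih' => exact ih.union ih'
  | all _ ih => exact ih

theorem primrecPred_exists_eq {g : ℕ → ℕ} (hg : Primrec g) (hmono : StrictMono g) :
    PrimrecPred fun c => ∃ n, g n = c := by
  have hR : PrimrecRel fun x y : ℕ => g x = y := Primrec.eq.comp (hg.comp .fst) .snd
  refine (hR.exists_lt.comp Primrec.succ .id).of_eq fun c => ?_
  refine exists_congr fun n => and_iff_right_of_imp fun hn => ?_
  exact Nat.lt_succ_of_le (hmono.le_apply.trans_eq hn)

theorem isFiniteSymbolRecursive_insert_range {k : ℕ} (φ : K.Formula (Fin k))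
    {ψ : ℕ → K.Formula (Fin k)} {T : Set K.Symbols} (hT : T.Finite)
    (hψ : ∀ n, formulaSymbols (ψ n) ⊆ T) (hcode : ∀ e, Primrec fun n => formulaCode e (ψ n))
    (hmono : ∀ e, StrictMono fun n => formulaCode e (ψ n)) :
    IsFiniteSymbolRecursive (insert φ (range ψ)) := by
  have hfin : (⋃ χ ∈ insert φ (range ψ), formulaSymbols χ).Finite := by
    simp only [biUnion_insert, biUnion_range]
    exact (finite_formulaSymbols φ).union (hT.subset (iUnion_subset hψ))
  obtain ⟨e, he⟩ := countable_iff_exists_injOn.1 hfin.countable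
  have hp : PrimrecPred fun c => ∃ χ ∈ insert φ (range ψ), formulaCode e χ = c :=
    ((Primrec.eq.comp (.const (formulaCode e φ)) .id).or
      (primrecPred_exists_eq (hcode e) (hmono e))).of_eq fun c => by
        simp only [exists_mem_insert, exists_range_iff, id]
  obtain ⟨_, hp⟩ := hp
  exact ⟨hfin, e, he, _, hp.to_comp⟩

section Numerals

variable (z : K.Constants) (s : K.Functions 1)

/-- The term `s (⋯ (s z))` with `n` occurrences of `s`. -/
def numeral (n : ℕ) : K.Term α := s.apply₁^[n] z.term

theorem numeral_succ (n : ℕ) : (numeral z s (n + 1) : K.Term α) = s.apply₁ (numeral z s n) :=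
  Function.iterate_succ_apply' ..

theorem termSymbols_numeral (n : ℕ) :
    termSymbols (numeral z s n : K.Term α) ⊆ {Sum.inl ⟨0, z⟩, Sum.inl ⟨1, s⟩} := by
  induction n with
  | zero => simp [numeral, Constants.term, termSymbols]
  | succ n ih =>
    rw [numeral_succ, Functions.apply₁, termSymbols]
    simpa [insert_subset_iff] using ih

theorem termCode_numeral (e : K.Symbols → ℕ) (k l n : ℕ) :
    termCode e (numeral z s n : K.Term (Fin k ⊕ Fin l)) =
      (fun x => Nat.pair 2 (Nat.pair (e (Sum.inl ⟨1, s⟩)) (Nat.pair x 0 + 1)))^[n]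
        (termCode e (z.term : K.Term (Fin k ⊕ Fin l))) := by
  induction n with
  | zero => rfl
  | succ n ih =>
    rw [Function.iterate_succ_apply', ← ih, numeral_succ, Functions.apply₁, termCode]
    simp

theorem primrec_termCode_numeral (e : K.Symbols → ℕ) (k l : ℕ) :
    Primrec fun n => termCode e (numeral z s n : K.Term (Fin k ⊕ Fin l)) := by
  simp only [termCode_numeral]
  exact Primrec.nat_iterate .id (.const _) (Primrec₂.natPair.comp (.const 2)
    (Primrec₂.natPair.comp (.const _)
      (Primrec.succ.comp (Primrec₂.natPair.comp .snd (.const 0)))))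

theorem strictMono_termCode_numeral (e : K.Symbols → ℕ) (k l : ℕ) :
    StrictMono fun n => termCode e (numeral z s n : K.Term (Fin k ⊕ Fin l)) := by
  refine strictMono_nat_of_lt_succ fun n => ?_
  simp only [termCode_numeral, Function.iterate_succ_apply']
  calc _ ≤ Nat.pair _ 0 := Nat.left_le_pair _ _
    _ < Nat.pair _ 0 + 1 := Nat.lt_succ_self _
    _ ≤ Nat.pair (e (Sum.inl ⟨1, s⟩)) _ := Nat.right_le_pair _ _
    _ ≤ _ := Nat.right_le_pair _ _

/-- The formula `v₀ ≠ s (⋯ (s z))` with `n` occurrences of `s`, in the variables `v₀, …, vₘ`. -/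
def neNumeral (m n : ℕ) : K.Formula (Fin (m + 1)) :=
  ∼ ((Term.var (Sum.inl 0)).bdEqual (numeral z s n))

theorem formulaSymbols_neNumeral (m n : ℕ) :
    formulaSymbols (neNumeral z s m n) ⊆ {Sum.inl ⟨0, z⟩, Sum.inl ⟨1, s⟩} := by
  simpa [neNumeral, formulaSymbols, termSymbols, Term.bdEqual, BoundedFormula.not] using!
    termSymbols_numeral z s n

theorem primrec_formulaCode_neNumeral (e : K.Symbols → ℕ) (m : ℕ) :
    Primrec fun n => formulaCode e (neNumeral z s m n) :=
  Primrec₂.natPair.comp (.const 3) (Primrec₂.natPair.comp (Primrec₂.natPair.comp (.const 1)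
    (Primrec₂.natPair.comp (.const _) (primrec_termCode_numeral z s e _ _))) (.const _))

theorem strictMono_formulaCode_neNumeral (e : K.Symbols → ℕ) (m : ℕ) :
    StrictMono fun n => formulaCode e (neNumeral z s m n) := fun _ _ h =>
  Nat.pair_lt_pair_right _ (Nat.pair_lt_pair_left _ (Nat.pair_lt_pair_right _
    (Nat.pair_lt_pair_right _ (strictMono_termCode_numeral z s e _ _ h))))

variable {M : Type w} [K.Structure M]

theorem realize_numeral (v : α → M) (n : ℕ) :
    (numeral z s n).realize v = (fun x => Structure.funMap s ![x])^[n] (z : M) := by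
  induction n with
  | zero => exact Term.realize_constants
  | succ n ih =>
    rw [numeral_succ, Term.realize_functions_apply₁, ih, Function.iterate_succ_apply']

theorem realize_neNumeral (m n : ℕ) (v : Fin (m + 1) → M) :
    (neNumeral z s m n).Realize v ↔ v 0 ≠ (fun x => Structure.funMap s ![x])^[n] (z : M) := by
  rw [neNumeral, Formula.Realize, BoundedFormula.realize_not, BoundedFormula.realize_bdEqual,
    realize_numeral]
  exact Iff.rfl

/-- If the iterates `sⁿ z` formed a definable set, then the recursive type saying that `v` lies in
this set and is different from each of them would be finitely satisfiable. -/
theorem IsPiecewiseRecursivelySaturated.not_definablePred_iterate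
    (hsat : IsPiecewiseRecursivelySaturated K M)
    (hinj : Function.Injective fun n => (fun x : M => Structure.funMap s ![x])^[n] (z : M)) :
    ¬ DefinablePred K fun v : Fin 1 → M =>
      ∃ n, (fun x => Structure.funMap s ![x])^[n] (z : M) = v 0 := by
  intro hdef
  obtain ⟨m, φ, p, hφ⟩ := hdef.exists_formula
    (P := fun x => ∃ n, (fun x => Structure.funMap s ![x])^[n] (z : M) = x)
  have hrec := isFiniteSymbolRecursive_insert_range φ (toFinite _)
    (formulaSymbols_neNumeral z s m) (fun e => primrec_formulaCode_neNumeral z s e m)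
    (fun e => strictMono_formulaCode_neNumeral z s e m)
  obtain ⟨x, hx⟩ := hsat m _ p hrec fun F hF => by
    have hne : Function.Injective (neNumeral z s m) := fun n n' h =>
      (strictMono_formulaCode_neNumeral z s (fun _ => 0) m).injective (congrArg _ h)
    obtain ⟨_, ⟨n, rfl⟩, hn⟩ := (infinite_range_of_injective hne).exists_notMem_finset F
    refine ⟨(fun x => Structure.funMap s ![x])^[n] z, fun χ hχ => ?_⟩
    rcases hF hχ with rfl | ⟨k, rfl⟩
    · exact (hφ _).2 ⟨n, rfl⟩
    · exact (realize_neNumeral z s m k _).2 fun h => hn (hinj h ▸ hχ)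
  obtain ⟨n, hn⟩ := (hφ x).1 (hx φ (mem_insert _ _))
  exact (realize_neNumeral z s m n _).1 (hx _ (mem_insert_of_mem _ ⟨n, rfl⟩)) hn.symm

end Numerals

end Saturation

section Standard

open FirstOrder Language Set

theorem countable_symbols_LPA : Countable LPA.Symbols := by
  have (n : ℕ) : Countable (LPA.Functions n) :=
    Function.Injective.countable (f := LPAFunc.ctorIdx) fun f g h => by
      cases f <;> cases g <;> first | rfl | cases h
  have (n : ℕ) : Countable (LPA.Relations n) := inferInstanceAs (Countable Empty)
  exact inferInstanceAs (Countable ((Σ n, LPA.Functions n) ⊕ Σ n, LPA.Relations n))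

theorem countable_symbols_sum (K : FirstOrder.Language.{u, v}) (K' : FirstOrder.Language)
    [Countable K.Symbols] [Countable K'.Symbols] : Countable (K.sum K').Symbols := by
  have hcard : (K.sum K').card ≤ Cardinal.aleph0 := by
    rw [card_sum, Cardinal.add_le_aleph0, Cardinal.lift_le_aleph0, Cardinal.lift_le_aleph0]
    exact ⟨Cardinal.mk_le_aleph0, Cardinal.mk_le_aleph0⟩
  exact Cardinal.mk_le_aleph0_iff.1 hcard

variable {L : FirstOrder.Language.{u, v}} {M : Type w} [LPA.Structure M] [L.Structure M]

theorem IsModelPA.not_definable_isStandard (hPA : IsModelPA M)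
    (hsat : IsPiecewiseRecursivelySaturated (LPA.sum L) M) :
    ¬ (univ : Set M).Definable₁ (LPA.sum L) {x | IsStandard x} := by
  let z : (LPA.sum L).Constants := Sum.inl LPAFunc.zero
  have hz : (z : M) = zero :=
    congrArg (Structure.funMap (L := LPA) LPAFunc.zero) (Subsingleton.elim _ _)
  have h := hsat.not_definablePred_iterate z (Sum.inl LPAFunc.succ)
  rw [hz] at h
  exact h hPA.injective_iterate_succ_zero

theorem exists_not_isStandard
    (hstd : ¬ (univ : Set M).Definable₁ (LPA.sum L) {x | IsStandard x}) :
    ∃ a : M, ¬ IsStandard a := by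
  by_contra! h
  exact hstd ((congrArg (Definable univ (LPA.sum L)) (eq_univ_of_forall fun v => h (v 0))).mpr
    definable_univ)

end Standard

section Forcing

open FirstOrder Language Set Filter

variable (K : FirstOrder.Language.{u, v}) (M : Type w) [K.Structure M] [LinearOrder M]

/-- The collection scheme for the definable binary relations of a linearly ordered structure. -/
def HasCollection : Prop :=
  ∀ R : M → M → Prop, DefinablePred K (fun v : Fin 2 → M => R (v 0) (v 1)) →
    ∀ a, (∀ x ≤ a, ∃ y, R x y) → ∃ b, ∀ x ≤ a, ∃ y ≤ b, R x y

/-- A forcing condition: a definable decreasing family, indexed by `u ∈ M`, of nonempty sets of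
assignments. A generic filter of conditions determines an extension of `M` whose elements are
named by the variables `i : ι`. -/
structure Condition (ι : Type*) where
  /-- The assignment `s` belongs to the `u`-th set of the family. -/
  rel : M → (ι → M) → Prop
  definable : DefinablePred K fun v : Option ι → M => rel (v none) fun i => v (some i)
  antitone : Antitone rel
  nonempty : ∀ u, ∃ s, rel u s

variable {K M} {ι : Type*}

namespace Condition

/-- The filter generated by the sets of a condition. -/
def filter (D : Condition K M ι) : Filter (ι → M) := ⨅ u, 𝓟 {s | D.rel u s}

/-- Stronger conditions are larger. -/
instance : Preorder (Condition K M ι) :=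
  Preorder.lift fun D => OrderDual.toDual D.filter

theorem filter_antitone : Antitone (filter : Condition K M ι → Filter (ι → M)) :=
  fun _ _ h => h

theorem eventually_rel (D : Condition K M ι) (u : M) : ∀ᶠ s in D.filter, D.rel u s :=
  mem_iInf_of_mem u (mem_principal_self _)

theorem directed_principal (D : Condition K M ι) :
    Directed (· ≥ ·) fun u => 𝓟 {s | D.rel u s} :=
  Antitone.directed_ge fun _ _ h => principal_mono.2 (D.antitone h)

theorem le_iff {D E : Condition K M ι} : D ≤ E ↔ ∀ u, ∀ᶠ s in E.filter, D.rel u s :=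
  le_iInf_iff.trans (forall_congr' fun _ => le_principal_iff)

/-- The restriction of a condition to a definable decreasing family compatible with it. -/
def restrict (D : Condition K M ι) (Q : M → (ι → M) → Prop)
    (hQ : DefinablePred K fun v : Option ι → M => Q (v none) fun i => v (some i))
    (hanti : Antitone Q) (hne : ∀ u, ∃ s, D.rel u s ∧ Q u s) : Condition K M ι where
  rel u s := D.rel u s ∧ Q u s
  definable := D.definable.and hQ
  antitone _ _ h s hs := ⟨D.antitone h s hs.1, hanti h s hs.2⟩
  nonempty := hne

theorem le_restrict (D : Condition K M ι) {Q : M → (ι → M) → Prop}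
    (hQ : DefinablePred K fun v : Option ι → M => Q (v none) fun i => v (some i))
    (hanti : Antitone Q) (hne : ∀ u, ∃ s, D.rel u s ∧ Q u s) :
    D ≤ D.restrict Q hQ hanti hne :=
  le_iff.2 fun u => ((D.restrict Q hQ hanti hne).eventually_rel u).mono fun _ => And.left

theorem eventually_restrict (D : Condition K M ι) {Q : M → (ι → M) → Prop}
    (hQ : DefinablePred K fun v : Option ι → M => Q (v none) fun i => v (some i))
    (hanti : Antitone Q) (hne : ∀ u, ∃ s, D.rel u s ∧ Q u s) (u : M) :
    ∀ᶠ s in (D.restrict Q hQ hanti hne).filter, Q u s :=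
  ((D.restrict Q hQ hanti hne).eventually_rel u).mono fun _ => And.right

variable [Nonempty M]

instance neBot_filter (D : Condition K M ι) : D.filter.NeBot :=
  iInf_neBot_of_directed' D.directed_principal fun u => principal_neBot_iff.2 (D.nonempty u)

theorem eventually_filter (D : Condition K M ι) {p : (ι → M) → Prop} :
    (∀ᶠ s in D.filter, p s) ↔ ∃ u, ∀ s, D.rel u s → p s :=
  mem_iInf_of_directed D.directed_principal _

end Condition

end Forcing

section Density

open FirstOrder Language Set Filter Function

variable {K : FirstOrder.Language.{u, v}} {M : Type w} [K.Structure M] {ι : Type*}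

/-- Some variable names, `F`-almost everywhere, a witness of `R` if there is one. -/
def HasWitness (F : Filter (ι → M)) (R : (ι → M) → M → Prop) : Prop :=
  ∃ j, ∀ᶠ s in F, (∃ y, R s y) → R s (s j)

variable (K) in
/-- Every definable relation has a witnessing variable, as in a Henkin theory. -/
def IsHenkin (F : Filter (ι → M)) : Prop :=
  ∀ R : (ι → M) → M → Prop,
    DefinablePred K (fun v : Option ι → M => R (fun i => v (some i)) (v none)) → HasWitness F R

theorem antitone_hasWitness (R : (ι → M) → M → Prop) :
    Antitone fun F : Filter (ι → M) => HasWitness F R :=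
  fun _ _ h ⟨j, hj⟩ => ⟨j, h hj⟩

variable [LinearOrder M]

/-- The filter `F` decides whether variable `i` lies above `a`, and its value if it does not. -/
def DecidesBelow (F : Filter (ι → M)) (i : ι) (a : M) : Prop :=
  (∀ᶠ s in F, a < s i) ∨ ∃ m ≤ a, ∀ᶠ s in F, s i = m

/-- On some infinite interval `[0, a'] ⊆ [0, a]`, the values of the relation `R` that are not above
every element of `M` are bounded in `M`. -/
def HasLocalBound (F : Filter (ι → M)) (R : (ι → M) → M → M → Prop) (a : M) : Prop :=
  ∃ a' ≤ a, (Iic a').Infinite ∧ ∃ b, ∀ u, ∀ᶠ s in F, ∀ x ≤ a', ∀ y, R s x y → y ≤ b ∨ u < y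

theorem antitone_decidesBelow (i : ι) (a : M) :
    Antitone fun F : Filter (ι → M) => DecidesBelow F i a :=
  fun _ _ h => Or.imp (h ·) fun ⟨m, hm, h'⟩ => ⟨m, hm, h h'⟩

theorem antitone_hasLocalBound (R : (ι → M) → M → M → Prop) (a : M) :
    Antitone fun F : Filter (ι → M) => HasLocalBound F R a :=
  fun _ _ h ⟨a', ha', hinf, b, hb⟩ => ⟨a', ha', hinf, b, fun u => h (hb u)⟩

theorem DefinablePred.lt {α : Type*}
    (hlt : DefinablePred K fun v : Fin 2 → M => v 0 < v 1) {f g : (α → M) → M}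
    (hf : (univ : Set M).DefinableFun K f) (hg : (univ : Set M).DefinableFun K g) :
    DefinablePred K fun v => f v < g v :=
  .subst₂ hlt hf hg

theorem DefinablePred.le {α : Type*}
    (hlt : DefinablePred K fun v : Fin 2 → M => v 0 < v 1) {f g : (α → M) → M}
    (hf : (univ : Set M).DefinableFun K f) (hg : (univ : Set M).DefinableFun K g) :
    DefinablePred K fun v => f v ≤ g v := by
  simpa only [not_lt] using (DefinablePred.lt hlt hg hf).not

theorem exists_infinite_of_forall_finite
    (hfin : ¬ DefinablePred K fun v : Fin 1 → M => (Iic (v 0)).Finite) {P : M → Prop}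
    (hP : DefinablePred K fun v : Fin 1 → M => P (v 0)) (h : ∀ a, (Iic a).Finite → P a) :
    ∃ a, P a ∧ (Iic a).Infinite := by
  by_contra! hinf
  refine hfin ((congrArg (DefinablePred K) (funext fun v => propext ?_)).mp hP)
  exact ⟨hinf _, h _⟩

namespace Condition

variable [Nonempty M]

theorem exists_hasWitness [Infinite ι] (D : Condition K M ι) {R : (ι → M) → M → Prop}
    (hR : DefinablePred K fun v : Option ι → M => R (fun i => v (some i)) (v none)) :
    ∃ E : Condition K M ι, D ≤ E ∧ HasWitness E.filter R := by
  classical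
  obtain ⟨S, hS⟩ := D.definable.exists_finset_support
  obtain ⟨T, hT⟩ := hR.exists_finset_support
  obtain ⟨j, hj⟩ := Infinite.exists_notMem_finset (S.eraseNone ∪ T.eraseNone)
  simp only [Finset.mem_union, Finset.mem_eraseNone, not_or] at hj
  -- variable `j` occurs neither in `D` nor in `R`
  have agree {A : Finset (Option ι)} (hA : some j ∉ A) (s : ι → M) (y z : M) :
      ∀ o ∈ A, o.elim z (update s j y) = o.elim z s := by
    rintro (_ | i) ho
    · rfl
    · exact update_of_ne (fun hij : i = j => hA (hij ▸ ho)) _ _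
  have hDj (u s y) : D.rel u (update s j y) ↔ D.rel u s :=
    hS (fun o => o.elim u (update s j y)) (fun o => o.elim u s) (agree hj.1 s y u)
  have hRj (s y z) : R (update s j y) z ↔ R s z :=
    hT (fun o => o.elim z (update s j y)) (fun o => o.elim z s) (agree hj.2 s y z)
  have hdef : DefinablePred K fun v : Option ι → M =>
      (∃ y, R (fun i => v (some i)) y) → R (fun i => v (some i)) (v (some j)) :=
    .imp (.exists_var (hR.reindex fun o => o.elim none (some ∘ some)))
      (hR.reindex fun o => o.elim (some j) some)
  have hne (u) : ∃ s, D.rel u s ∧ ((∃ y, R s y) → R s (s j)) := by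
    obtain ⟨s, hs⟩ := D.nonempty u
    by_cases h : ∃ y, R s y
    · obtain ⟨y, hy⟩ := h
      refine ⟨update s j y, (hDj u s y).2 hs, fun _ => ?_⟩
      rwa [update_self, hRj]
    · exact ⟨s, hs, fun h' => (h h').elim⟩
  have hanti : Antitone fun (_ : M) (s : ι → M) => (∃ y, R s y) → R s (s j) := antitone_const
  exact ⟨_, D.le_restrict hdef hanti hne, j,
    D.eventually_restrict hdef hanti hne (Classical.arbitrary M)⟩

/-- If no value `m ≤ a` of variable `i` is compatible with `D`, then by collection a single member
of the family `D` excludes them all. -/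
theorem exists_decidesBelow (hcoll : HasCollection K M) (D : Condition K M ι) (i : ι) (a : M) :
    ∃ E : Condition K M ι, D ≤ E ∧ DecidesBelow E.filter i a := by
  by_cases h : ∃ m ≤ a, ∀ u, ∃ s, D.rel u s ∧ s i = m
  · obtain ⟨m, hm, h⟩ := h
    have hdef : DefinablePred K fun v : Option ι → M => v (some i) = m :=
      .eq (by fun_prop) (by fun_prop)
    exact ⟨D.restrict (fun _ s => s i = m) hdef antitone_const h, D.le_restrict _ _ _,
      .inr ⟨m, hm, D.eventually_restrict _ _ _ m⟩⟩
  · push Not at h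
    obtain ⟨b, hb⟩ := hcoll (fun m u => ¬ ∃ s, D.rel u s ∧ s i = m)
      (.not (.exists_block (.and (D.definable.reindex fun o => o.elim (Sum.inl 1) Sum.inr)
        (.eq (by fun_prop) (by fun_prop))))) a (by simpa only [not_exists, not_and] using h)
    refine ⟨D, le_rfl, .inl (D.eventually_filter.2 ⟨b, fun s hs => lt_of_not_ge fun hle => ?_⟩)⟩
    obtain ⟨u, hub, hu⟩ := hb (s i) hle
    exact hu ⟨s, D.antitone hub s hs, rfl⟩

theorem exists_bound_or_unbounded (hlt : DefinablePred K fun v : Fin 2 → M => v 0 < v 1)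
    (D : Condition K M ι) {R : (ι → M) → M → Prop}
    (hR : DefinablePred K fun v : Option ι → M => R (fun i => v (some i)) (v none))
    (hfun : ∀ s y y', R s y → R s y' → y = y') :
    ∃ E : Condition K M ι, D ≤ E ∧
      ∃ b, ∀ u, ∀ᶠ s in E.filter, ∀ y, R s y → y ≤ b ∨ u < y := by
  have hR' : DefinablePred K fun v : Option (Option ι) → M =>
      R (fun i => v (some (some i))) (v none) :=
    hR.reindex fun o => o.elim none (some ∘ some)
  by_cases h : ∃ b, ∀ u, ∃ s, D.rel u s ∧ ∀ y, R s y → y ≤ b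
  · obtain ⟨b, hb⟩ := h
    have hdef : DefinablePred K fun v : Option ι → M => ∀ y, R (fun i => v (some i)) y → y ≤ b :=
      .forall_var (.imp hR' (.le hlt (by fun_prop) (by fun_prop)))
    exact ⟨D.restrict (fun _ s => ∀ y, R s y → y ≤ b) hdef antitone_const hb,
      D.le_restrict _ _ _, b, fun u => (D.eventually_restrict _ _ _ u).mono
        fun s hs y hy => .inl (hs y hy)⟩
  · push Not at h
    have hdef : DefinablePred K fun v : Option ι → M =>
        ∀ y, R (fun i => v (some i)) y → v none < y :=
      .forall_var (.imp hR' (.lt hlt (by fun_prop) (by fun_prop)))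
    have hne (u) : ∃ s, D.rel u s ∧ ∀ y, R s y → u < y := by
      obtain ⟨u₀, hu₀⟩ := h u
      obtain ⟨s, hs⟩ := D.nonempty (max u u₀)
      obtain ⟨y, hy, huy⟩ := hu₀ s (D.antitone (le_max_right _ _) s hs)
      exact ⟨s, D.antitone (le_max_left _ _) s hs, fun y' hy' => hfun s y y' hy hy' ▸ huy⟩
    exact ⟨D.restrict (fun u s => ∀ y, R s y → u < y) hdef
      (fun u u' huu' s hs y hy => huu'.trans_lt (hs y hy)) hne,
      D.le_restrict _ _ _, Classical.arbitrary M, fun u => (D.eventually_restrict _ _ _ u).mono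
        fun s hs y hy => .inr (hs y hy)⟩

theorem exists_bound_of_finite (hlt : DefinablePred K fun v : Fin 2 → M => v 0 < v 1)
    (D : Condition K M ι) {R : (ι → M) → M → M → Prop}
    (hR : DefinablePred K fun v : Option (Option ι) → M =>
      R (fun i => v (some (some i))) (v (some none)) (v none))
    (hfun : ∀ s x y y', R s x y → R s x y' → y = y') {X : Set M} (hX : X.Finite) :
    ∃ E : Condition K M ι, D ≤ E ∧
      ∃ b, ∀ u, ∀ᶠ s in E.filter, ∀ x ∈ X, ∀ y, R s x y → y ≤ b ∨ u < y := by
  induction X, hX using Set.Finite.induction_on with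
  | empty => exact ⟨D, le_rfl, Classical.arbitrary M, by simp⟩
  | @insert x X _ _ ih =>
    obtain ⟨E, hDE, b, hb⟩ := ih
    have hRx : DefinablePred K fun v : Option ι → M => R (fun i => v (some i)) x (v none) :=
      .specialize (P := fun v x => R (fun i => v (some i)) x (v none)) (hR.reindex fun
        | none => some none
        | some none => none
        | some (some i) => some (some i)) x
    obtain ⟨E', hEE', b', hb'⟩ := E.exists_bound_or_unbounded hlt hRx fun s => hfun s x
    refine ⟨E', hDE.trans hEE', max b b', fun u => ?_⟩
    filter_upwards [hb' u, filter_antitone hEE' (hb u)] with s hs' hs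
    rintro x' (rfl | hx') y hy
    · exact (hs' y hy).imp_left le_max_of_le_right
    · exact (hs x' hx' y hy).imp_left le_max_of_le_left

/-- Every finite interval admits a bound. Since finiteness of intervals is not definable, some
infinite one does too. -/
theorem exists_hasLocalBound (hlt : DefinablePred K fun v : Fin 2 → M => v 0 < v 1)
    (hfin : ¬ DefinablePred K fun v : Fin 1 → M => (Iic (v 0)).Finite)
    (D : Condition K M ι) {R : (ι → M) → M → M → Prop}
    (hR : DefinablePred K fun v : Option (Option ι) → M =>
      R (fun i => v (some (some i))) (v (some none)) (v none))
    (hfun : ∀ s x y y', R s x y → R s x y' → y = y') {a : M} (ha : (Iic a).Infinite) :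
    ∃ E : Condition K M ι, D ≤ E ∧ HasLocalBound E.filter R a := by
  let B (a' b u : M) (s : ι → M) : Prop := ∀ x ≤ a', ∀ y, R s x y → y ≤ b ∨ u < y
  let V (a' : M) : Prop := a' ≤ a ∧ ∃ b, ∀ u, ∃ s, D.rel u s ∧ B a' b u s
  have hVdef : DefinablePred K fun v : Fin 1 → M => V (v 0) :=
    .and (.le hlt (by fun_prop) (by fun_prop)) (.exists_var (.forall_var (.exists_block (.and
      (D.definable.reindex fun
        | none => Sum.inl none
        | some i => Sum.inr i)
      (.forall_var (.imp (.le hlt (by fun_prop) (by fun_prop)) (.forall_var (.imp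
        (hR.reindex fun
          | none => none
          | some none => some none
          | some (some i) => some (some (Sum.inr i)))
        (.or (.le hlt (by fun_prop) (by fun_prop)) (.lt hlt (by fun_prop) (by fun_prop)))))))))))
  have hV (a') (ha' : (Iic a').Finite) : V a' := by
    obtain ⟨E, hDE, b, hb⟩ := D.exists_bound_of_finite hlt hR hfun ha'
    refine ⟨le_of_not_ge fun h => ha (ha'.subset (Iic_subset_Iic.2 h)), b, fun u => ?_⟩
    exact ((le_iff.1 hDE u).and (hb u)).exists
  obtain ⟨a', ⟨ha'a, b, hb⟩, ha'⟩ : ∃ a', V a' ∧ (Iic a').Infinite :=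
    exists_infinite_of_forall_finite hfin hVdef hV
  have hBdef : DefinablePred K fun v : Option ι → M => B a' b (v none) fun i => v (some i) :=
    .forall_var (.imp (.le hlt (by fun_prop) (by fun_prop)) (.forall_var (.imp
      (hR.reindex fun
        | none => none
        | some none => some none
        | some (some i) => some (some (some i)))
      (.or (.le hlt (by fun_prop) (by fun_prop)) (.lt hlt (by fun_prop) (by fun_prop))))))
  have hanti : Antitone (B a' b) := fun u u' h s hs x hx y hy =>
    (hs x hx y hy).imp_right h.trans_lt
  exact ⟨D.restrict (B a' b) hBdef hanti hb, D.le_restrict _ _ _, a', ha'a, ha', b,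
    D.eventually_restrict _ _ _⟩

end Condition

end Density

section Generic

open FirstOrder Language Set Filter

variable {K : FirstOrder.Language.{u, v}} {M : Type w} [K.Structure M] [LinearOrder M]
  {ι : Type*}

/-- The condition that variable `i` exceeds every element of `M`, which makes the extension
proper. -/
def Condition.unbounded [NoMaxOrder M] (hlt : DefinablePred K fun v : Fin 2 → M => v 0 < v 1)
    (i : ι) : Condition K M ι where
  rel u s := u < s i
  definable := .lt hlt (by fun_prop) (by fun_prop)
  antitone _ _ h _ hs := h.trans_lt hs
  nonempty u := (exists_gt u).imp' (fun y _ => y) fun _ => id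

variable [Nonempty M]

theorem exists_ultrafilter_of_dense {κ : Type*} [Countable κ] (D₀ : Condition K M ι)
    {p : κ → Filter (ι → M) → Prop} (hanti : ∀ k, Antitone (p k))
    (hdense : ∀ k (D : Condition K M ι), ∃ E, D ≤ E ∧ p k E.filter) :
    ∃ U : Ultrafilter (ι → M), ↑U ≤ D₀.filter ∧ ∀ k, p k U := by
  have := Encodable.ofCountable κ
  let 𝒟 (k : κ) : Order.Cofinal (Condition K M ι) :=
    ⟨{E | p k E.filter}, fun D => (hdense k D).imp fun _ => And.symm⟩
  let G := Order.idealOfCofinals D₀ 𝒟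
  have : Nonempty G := G.nonempty.to_subtype
  have hdir : Directed (· ≥ ·) fun D : G => D.1.filter := fun D E => by
    obtain ⟨C, hC, hDC, hEC⟩ := G.directed D.1 D.2 E.1 E.2
    exact ⟨⟨C, hC⟩, Condition.filter_antitone hDC, Condition.filter_antitone hEC⟩
  have hne : (⨅ D : G, D.1.filter).NeBot := iInf_neBot_of_directed' hdir fun _ => inferInstance
  let U := Ultrafilter.of (⨅ D : G, D.1.filter)
  have hU (D) (hD : D ∈ G) : ↑U ≤ D.filter :=
    (Ultrafilter.of_le _).trans (iInf_le (fun D : G => D.1.filter) ⟨D, hD⟩)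
  refine ⟨U, hU D₀ (Order.mem_idealOfCofinals D₀ 𝒟), fun k => ?_⟩
  obtain ⟨D, hDk, hD⟩ := Order.cofinal_meets_idealOfCofinals D₀ 𝒟 k
  exact hanti k (hU D hD) hDk

variable (K) in
/-- A filter of assignments that meets the dense sets of conditions needed to read off a locally
semiregular end-extension. -/
structure IsGeneric (F : Filter (ι → M)) : Prop where
  isHenkin : IsHenkin K F
  decidesBelow : ∀ i a, DecidesBelow F i a
  hasLocalBound : ∀ R : (ι → M) → M → M → Prop,
    DefinablePred K (fun v : Option (Option ι) → M =>
      R (fun i => v (some (some i))) (v (some none)) (v none)) →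
    (∀ s x y y', R s x y → R s x y' → y = y') → ∀ a, (Iic a).Infinite → HasLocalBound F R a

theorem exists_isGeneric [Infinite ι] [Countable ι] [Countable M] [Countable K.Symbols]
    (hlt : DefinablePred K fun v : Fin 2 → M => v 0 < v 1) (hcoll : HasCollection K M)
    (hfin : ¬ DefinablePred K fun v : Fin 1 → M => (Iic (v 0)).Finite) (D₀ : Condition K M ι) :
    ∃ U : Ultrafilter (ι → M), ↑U ≤ D₀.filter ∧ IsGeneric K (U : Filter (ι → M)) := by
  have := countable_definableRel (K := K) (M := M) (α := ι)
  have := countable_definableRel₂ (K := K) (M := M) (α := ι)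
  let W := {R : (ι → M) → M → Prop //
    DefinablePred K fun v : Option ι → M => R (fun i => v (some i)) (v none)}
  let B := {R : (ι → M) → M → M → Prop // DefinablePred K fun v : Option (Option ι) → M =>
    R (fun i => v (some (some i))) (v (some none)) (v none)}
  let B' := {R : B // ∀ s x y y', R.1 s x y → R.1 s x y' → y = y'} × {a : M // (Iic a).Infinite}
  let p : W ⊕ (ι × M) ⊕ B' → Filter (ι → M) → Prop :=
    Sum.elim (fun R F => HasWitness F R.1) (Sum.elim (fun q F => DecidesBelow F q.1 q.2)
      fun q F => HasLocalBound F q.1.1.1 q.2)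
  have hanti : ∀ k, Antitone (p k) := by
    rintro (R | q | q)
    exacts [antitone_hasWitness _, antitone_decidesBelow _ _, antitone_hasLocalBound _ _]
  have hdense : ∀ k (D : Condition K M ι), ∃ E, D ≤ E ∧ p k E.filter := by
    rintro (R | q | q) D
    · exact D.exists_hasWitness R.2
    · exact D.exists_decidesBelow hcoll q.1 q.2
    · exact D.exists_hasLocalBound hlt hfin q.1.1.2 q.1.2 q.2.2
  obtain ⟨U, hUD, hU⟩ := exists_ultrafilter_of_dense D₀ hanti hdense
  exact ⟨U, hUD, fun R hR => hU (.inl ⟨R, hR⟩), fun i a => hU (.inr (.inl (i, a))),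
    fun R hR hfun a ha => hU (.inr (.inr (⟨⟨R, hR⟩, hfun⟩, ⟨a, ha⟩)))⟩

end Generic

section HenkinUltrapower

universe t

open FirstOrder Language Set Filter

variable {K : FirstOrder.Language.{u, v}} {M : Type w} [K.Structure M] {ι : Type t}

/-- The elementary extension `j : M → N` consists of the values `name i` of the variables, and the
truth of formulas about them is read off the ultrafilter `U` of assignments. -/
structure IsNaming {N : Type*} [K.Structure N] (U : Ultrafilter (ι → M)) (j : M ↪ₑ[K] N)
    (name : ι → N) : Prop where
  surjective : Function.Surjective name
  realize_iff : ∀ φ : K.Formula (M ⊕ ι),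
    φ.Realize (Sum.elim j name) ↔ ∀ᶠ s : ι → M in U, φ.Realize (Sum.elim id s)

/-- The element of the ultrapower of `M` that is named by the variable `i`. -/
def named (U : Ultrafilter (ι → M)) (i : ι) : (U : Filter (ι → M)).Product fun _ => M :=
  ((fun s => s i : (ι → M) → M) : (U : Filter (ι → M)).Product fun _ => M)

variable {U : Ultrafilter (ι → M)}

theorem IsHenkin.exists_eventually_eq (hU : IsHenkin K (U : Filter (ι → M))) (m : M) :
    ∃ i, ∀ᶠ s : ι → M in U, s i = m :=
  (hU (fun _ y => y = m) (.eq (by fun_prop) (by fun_prop))).imp fun _ h =>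
    h.mono fun _ hs => hs ⟨m, rfl⟩

variable [Nonempty M]

theorem realize_named {α : Type*} (φ : K.Formula α) (i : α → ι) :
    (φ.Realize fun a => named U (i a)) ↔ ∀ᶠ s : ι → M in U, φ.Realize fun a => s (i a) :=
  Ultraproduct.realize_formula_cast φ fun a (s : ι → M) => s (i a)

theorem IsHenkin.meetsDefinable (hU : IsHenkin K (U : Filter (ι → M))) :
    K.MeetsDefinable (range (named U)) := by
  rintro D ⟨x, hx⟩ hD
  obtain ⟨φ, hφ⟩ := definable_iff_exists_formula_sum.1 hD
  choose i hi using fun a : range (named U) => a.2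
  have mem_iff (g : (ι → M) → M) :
      (g : (U : Filter (ι → M)).Product fun _ => M) ∈ D ↔
        ∀ᶠ s : ι → M in U, φ.Realize (Sum.elim (fun a => s (i a)) fun _ => g s) := by
    have h := Ultraproduct.realize_formula_cast (u := U) φ
      (Sum.elim (fun a s => s (i a)) fun _ => g)
    refine (Set.ext_iff.1 hφ fun _ => _).trans (Iff.trans (iff_of_eq (congrArg φ.Realize ?_))
      (h.trans (eventually_congr (.of_forall fun s => iff_of_eq (congrArg φ.Realize ?_)))))
    · funext o
      rcases o with a | _
      exacts [(hi a).symm, rfl]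
    · funext o
      cases o <;> rfl
  obtain ⟨k, hk⟩ := hU (fun s y => φ.Realize (Sum.elim (fun a => s (i a)) fun _ => y)) (by
    convert (definablePred_realize (M := M) φ).reindex
      (Sum.elim (fun a => some (i a)) fun _ => none) using 3
    exact (Sum.comp_elim ..).symm)
  obtain ⟨g, rfl⟩ := Quotient.exists_rep x
  exact ⟨named U k, (mem_iff _).2 (((mem_iff g).1 hx).mp
    (hk.mono fun s hs h => hs ⟨_, h⟩)), k, rfl⟩

theorem IsHenkin.exists_isNaming (hU : IsHenkin K (U : Filter (ι → M))) :
    ∃ (N : Type (max w t)) (_ : K.Structure N) (j : M ↪ₑ[K] N) (name : ι → N),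
      IsNaming U j name := by
  let N := hU.meetsDefinable.toElementarySubstructure
  have mem_iff (x) : x ∈ N ↔ x ∈ range (named U) :=
    (congrArg (x ∈ ·) hU.meetsDefinable.closure_eq_self).to_iff
  let name (i : ι) : N := ⟨named U i, (mem_iff _).2 ⟨i, rfl⟩⟩
  choose c hc using hU.exists_eventually_eq
  have realize_iff (φ : K.Formula (M ⊕ ι)) :
      φ.Realize (Sum.elim (name ∘ c) name) ↔ ∀ᶠ s : ι → M in U, φ.Realize (Sum.elim id s) := by
    obtain ⟨S, hS⟩ := (definablePred_realize (M := M) φ).exists_finset_support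
    have hc' : ∀ᶠ s : ι → M in U, ∀ o ∈ S, s (Sum.elim c id o) = Sum.elim id s o :=
      (eventually_all_finset S).2 fun o _ => o.rec hc fun _ => .of_forall fun _ => rfl
    calc φ.Realize (Sum.elim (name ∘ c) name)
      _ ↔ φ.Realize (name ∘ Sum.elim c id) := by rw [Sum.comp_elim, Function.comp_id]
      _ ↔ φ.Realize fun o => named U (Sum.elim c id o) := (N.subtype.map_formula φ _).symm
      _ ↔ ∀ᶠ s : ι → M in U, φ.Realize fun o => s (Sum.elim c id o) := realize_named φ _
      _ ↔ _ := eventually_congr (hc'.mono fun s hs => hS _ _ hs)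
  have map_formula (n) (φ : K.Formula (Fin n)) (x : Fin n → M) :
      φ.Realize (name ∘ c ∘ x) ↔ φ.Realize x := by
    simpa [Formula.realize_relabel, ← Function.comp_assoc] using
      realize_iff (φ.relabel (Sum.inl ∘ x))
  refine ⟨N, inferInstance, ⟨name ∘ c, map_formula⟩, name, fun x => ?_, realize_iff⟩
  obtain ⟨i, hi⟩ := (mem_iff _).1 x.2
  exact ⟨i, Subtype.ext hi⟩

end HenkinUltrapower

section Extension

open FirstOrder Language Set Filter

variable {L : FirstOrder.Language.{u, v}} {M : Type w} [LPA.Structure M] [L.Structure M]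

theorem exists_eq_sumStructure {N : Type*} (S : (LPA.sum L).Structure N) :
    ∃ (_ : LPA.Structure N) (_ : L.Structure N), S = LPA.sumStructure L N := by
  refine ⟨(LHom.sumInl : LPA →ᴸ LPA.sum L).reduct N,
    (LHom.sumInr : L →ᴸ LPA.sum L).reduct N, ?_⟩
  ext n f x
  · cases f <;> rfl
  · cases f <;> rfl

theorem definablePred_realize_arith {α : Type*} (φ : LPA.Formula α) :
    DefinablePred (LPA.sum L) fun v : α → M => φ.Realize v := by
  simpa only [LHom.realize_onFormula] using
    definablePred_realize (M := M) ((LHom.sumInl : LPA →ᴸ LPA.sum L).onFormula φ)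

theorem definablePred_lt : DefinablePred (LPA.sum L) fun v : Fin 2 → M => Lt (v 0) (v 1) := by
  simpa only [realize_ltFormula] using definablePred_realize_arith (L := L) (M := M) ltFormula

theorem definablePred_beta {ι : Type*} (i k : ι) :
    DefinablePred (LPA.sum L) fun v : Option (Option ι) → M =>
      Beta (v (some (some i))) (v (some (some k))) (v (some none)) (v none) := by
  simpa only [realize_betaFormula] using!
    (definablePred_realize_arith (L := L) (M := M) betaFormula).reindex
      ![some (some i), some (some k), some none, none]

theorem SatisfiesCollection.hasCollection [LinearOrder M] (hle : ∀ x y : M, x ≤ y ↔ Le x y)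
    (hlt : ∀ x y : M, x < y ↔ Lt x y) (hM : IsModelPA M)
    (hcoll : SatisfiesCollection (LPA.sum L) M) : HasCollection (LPA.sum L) M := by
  intro R hR a ha
  obtain ⟨m, φ, p, hφ⟩ := hR.exists_formula₂
  obtain ⟨b, hb⟩ := hcoll m φ p (succ a) fun x hx =>
    (ha x ((hle x a).2 (hM.lt_succ_iff.1 hx))).imp fun y => (hφ x y).2
  refine ⟨b, fun x hx => ?_⟩
  obtain ⟨y, hyb, hxy⟩ := hb x (hM.lt_succ_iff.2 ((hle x a).1 hx))
  exact ⟨y, ((hlt y b).2 hyb).le, (hφ x y).1 hxy⟩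

variable {N : Type*} [LPA.Structure N] [L.Structure N]

section Embedding

variable (j : M ↪ₑ[LPA.sum L] N)

theorem map_zero : j zero = zero :=
  (j.map_fun (Sum.inl LPAFunc.zero) ![]).trans
    (congrArg (Structure.funMap (L := LPA) LPAFunc.zero) (Subsingleton.elim _ _))

theorem map_succ (m : M) : j (succ m) = succ (j m) :=
  (j.map_fun (Sum.inl LPAFunc.succ) ![m]).trans
    (congrArg (Structure.funMap (L := LPA) LPAFunc.succ) (funext fun i => by fin_cases i; rfl))

theorem map_iterate_succ_zero (n : ℕ) : j (succ^[n] zero) = succ^[n] zero := by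
  rw [Function.Semiconj.iterate_right (map_succ j) n, map_zero]

theorem isStandard_map_iff {m : M} : IsStandard (j m) ↔ IsStandard m :=
  exists_congr fun n => by rw [← map_iterate_succ_zero j, j.injective.eq_iff]

end Embedding

namespace IsNaming

variable {ι : Type*} {U : Ultrafilter (ι → M)} {j : M ↪ₑ[LPA.sum L] N} {name : ι → N}
  (h : IsNaming U j name)

include h

theorem realize_arith_iff {α : Type*} (φ : LPA.Formula α) (t : α → M ⊕ ι) :
    (φ.Realize fun a => Sum.elim j name (t a)) ↔
      ∀ᶠ s : ι → M in U, φ.Realize fun a => Sum.elim id s (t a) := by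
  simpa only [Formula.realize_relabel, LHom.realize_onFormula] using!
    h.realize_iff (((LHom.sumInl : LPA →ᴸ LPA.sum L).onFormula φ).relabel t)

theorem name_eq_iff {i : ι} {m : M} : name i = j m ↔ ∀ᶠ s : ι → M in U, s i = m := by
  simpa only [Formula.realize_equal] using!
    h.realize_iff ((Term.var (Sum.inr i)).equal (Term.var (Sum.inl m)))

theorem le_iff (x y : M ⊕ ι) : Le (Sum.elim j name x) (Sum.elim j name y) ↔
    ∀ᶠ s : ι → M in U, Le (Sum.elim id s x) (Sum.elim id s y) := by
  simpa only [realize_leFormula] using! h.realize_arith_iff leFormula ![x, y]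

theorem lt_iff (x y : M ⊕ ι) : Lt (Sum.elim j name x) (Sum.elim j name y) ↔
    ∀ᶠ s : ι → M in U, Lt (Sum.elim id s x) (Sum.elim id s y) := by
  simpa only [realize_ltFormula] using! h.realize_arith_iff ltFormula ![x, y]

theorem beta_iff (c d x y : M ⊕ ι) :
    Beta (Sum.elim j name c) (Sum.elim j name d) (Sum.elim j name x) (Sum.elim j name y) ↔
      ∀ᶠ s : ι → M in U,
        Beta (Sum.elim id s c) (Sum.elim id s d) (Sum.elim id s x) (Sum.elim id s y) := by
  simpa only [realize_betaFormula] using! h.realize_arith_iff betaFormula ![c, d, x, y]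

theorem map_le_iff {a b : M} : Le (j a) (j b) ↔ Le a b := by
  simpa only [Sum.elim_inl, id, eventually_const] using h.le_iff (.inl a) (.inl b)

variable [LinearOrder M] (hle : ∀ x y : M, x ≤ y ↔ Le x y) (hlt : ∀ x y : M, x < y ↔ Lt x y)

include hle hlt

theorem lt_or_exists_eq (hU : ∀ i a, DecidesBelow (U : Filter (ι → M)) i a) (c : N) (a : M) :
    Lt (j a) c ∧ ¬ Le c (j a) ∨ ∃ m, Le m a ∧ j m = c := by
  obtain ⟨i, rfl⟩ := h.surjective c
  rcases hU i a with hi | ⟨m, hm, hi⟩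
  · refine .inl ⟨(h.lt_iff (.inl a) (.inr i)).2 (hi.mono fun s => (hlt _ _).1), fun hle' => ?_⟩
    obtain ⟨s, hs, hs'⟩ := (hi.and ((h.le_iff (.inr i) (.inl a)).1 hle')).exists
    exact hs.not_ge ((hle _ _).2 hs')
  · exact .inr ⟨m, (hle _ _).1 hm, (h.name_eq_iff.2 hi).symm⟩

theorem isProperEndExtension (hU : ∀ i a, DecidesBelow (U : Filter (ι → M)) i a) (i : ι)
    (hi : ∀ u, ∀ᶠ s : ι → M in U, u < s i) : IsProperEndExtension j := by
  refine ⟨fun hj => ?_, fun c hc a =>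
    ((h.lt_or_exists_eq hle hlt hU c a).resolve_right fun ⟨m, _, hm⟩ => hc ⟨m, hm⟩).1⟩
  obtain ⟨m, hm⟩ : name i ∈ range j := hj ▸ mem_univ _
  obtain ⟨s, hs, hs'⟩ := ((h.name_eq_iff.1 hm.symm).and (hi m)).exists
  exact hs'.ne' hs

theorem isCut_range (hU : ∀ i a, DecidesBelow (U : Filter (ι → M)) i a) : IsCut (range j) := by
  constructor
  · rintro _ ⟨a, rfl⟩ b hb
    obtain ⟨m, -, hm⟩ := (h.lt_or_exists_eq hle hlt hU b a).resolve_left fun hlt => hlt.2 hb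
    exact ⟨m, hm⟩
  · rintro _ ⟨a, rfl⟩
    exact ⟨succ a, map_succ j a⟩

theorem isLocallySemiregular_range (hM : IsModelPA M) (hns : ∃ a : M, ¬ IsStandard a)
    (hU : IsGeneric (LPA.sum L) (U : Filter (ι → M))) : IsLocallySemiregular (range j) := by
  have infinite_Iic_iff (a : M) : (Iic a).Infinite ↔ ¬ IsStandard a := by
    rw [hM.isStandard_iff_finite, Set.Infinite, not_iff_not]
    exact iff_of_eq (congrArg Set.Finite (Set.ext fun y => hle y a))
  refine ⟨h.isCut_range hle hlt hU.decidesBelow, ?_, ?_⟩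
  · obtain ⟨a, ha⟩ := hns
    exact ⟨j a, mem_range_self a, (isStandard_map_iff j).not.2 ha⟩
  rintro _ ⟨a, rfl⟩ ha f ⟨c, d, hf⟩
  obtain ⟨i, rfl⟩ := h.surjective c
  obtain ⟨k, rfl⟩ := h.surjective d
  obtain ⟨a', ha'a, ha', b, hb⟩ := hU.hasLocalBound (fun s => Beta (s i) (s k))
    (definablePred_beta i k) (fun _ _ _ _ => hM.beta_unique) a
    ((infinite_Iic_iff a).2 ((isStandard_map_iff j).not.1 ha))
  refine ⟨j a', h.map_le_iff.2 ((hle _ _).1 ha'a),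
    (isStandard_map_iff j).not.2 ((infinite_Iic_iff a').1 ha'), j b, mem_range_self b, ?_⟩
  rintro x hx ⟨y, hy⟩
  obtain ⟨m, hm, hmx⟩ := (h.lt_or_exists_eq hle hlt hU.decidesBelow x.1 a').resolve_left
    fun hlt => hlt.2 hx
  have hβ : Beta (name i) (name k) (j m) (j y) := by
    rw [hmx, hy]
    exact hf x
  obtain ⟨s, hs, hsb⟩ :=
    (((h.beta_iff (.inr i) (.inr k) (.inl m) (.inl y)).1 hβ).and (hb y)).exists
  rw [← hy, h.map_le_iff, ← hle]
  exact (hsb m ((hle _ _).2 hm) y hs).resolve_right (lt_irrefl y)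

end IsNaming

end Extension

end Arith

theorem mainTheorem7_general (L : FirstOrder.Language.{u, v}) [Countable L.Symbols]
    (M : Type w) [Countable M] [Arith.LPA.Structure M] [L.Structure M]
    (hPA : Arith.IsModelPA M)
    (hcoll : Arith.SatisfiesCollection (Arith.LPA.sum L) M)
    (hstd : ¬ (Set.univ : Set M).Definable₁ (Arith.LPA.sum L) {x | Arith.IsStandard x}) :
    ∃ (N : Type w) (_ : Arith.LPA.Structure N) (_ : L.Structure N)
      (j : M ↪ₑ[Arith.LPA.sum L] N),
      Arith.IsProperEndExtension j ∧ Arith.IsLocallySemiregular (Set.range j) := by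
  have := Arith.countable_symbols_LPA
  have := Arith.countable_symbols_sum Arith.LPA L
  let _ := hPA.linearOrder
  have hle : ∀ x y : M, x ≤ y ↔ Arith.Le x y := fun _ _ => Iff.rfl
  have hlt : ∀ x y : M, x < y ↔ Arith.Lt x y := fun _ _ => Iff.rfl
  have hltdef : Arith.DefinablePred (Arith.LPA.sum L) fun v : Fin 2 → M => v 0 < v 1 :=
    Arith.definablePred_lt
  have : NoMaxOrder M := ⟨fun a => ⟨Arith.succ a, hPA.lt_succ_iff.2 (hPA.le_refl a)⟩⟩
  obtain ⟨U, hUD, hU⟩ := Arith.exists_isGeneric hltdef (hcoll.hasCollection hle hlt hPA)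
    (by simpa only [hPA.isStandard_iff_finite] using! hstd) (.unbounded hltdef (0 : ℕ))
  have hunb (u : M) : ∀ᶠ s : ℕ → M in U, u < s 0 := hUD (Arith.Condition.eventually_rel _ u)
  obtain ⟨N, S, j, name, h⟩ := hU.isHenkin.exists_isNaming
  obtain ⟨_, _, rfl⟩ := Arith.exists_eq_sumStructure S
  exact ⟨N, _, _, j, h.isProperEndExtension hle hlt hU.decidesBelow 0 hunb,
    h.isLocallySemiregular_range hle hlt hPA (Arith.exists_not_isStandard hstd) hU⟩

/-- A signature extending the language of arithmetic is `LPA.sum L`, where `L` consists of the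
additional symbols; a structure for it is a structure for `LPA` together with one for `L`. -/
theorem mainTheorem7 (L : FirstOrder.Language.{u, v}) [Countable L.Symbols]
    (M : Type w) [Countable M] [Arith.LPA.Structure M] [L.Structure M]
    (hPA : Arith.IsModelPA M)
    (hcoll : Arith.SatisfiesCollection (Arith.LPA.sum L) M)
    (hsat : Arith.IsPiecewiseRecursivelySaturated (Arith.LPA.sum L) M) :
    ∃ (N : Type w) (_ : Arith.LPA.Structure N) (_ : L.Structure N)
      (j : M ↪ₑ[Arith.LPA.sum L] N),
      Arith.IsProperEndExtension j ∧ Arith.IsLocallySemiregular (Set.range j) :=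
  mainTheorem7_general L M hPA hcoll (hPA.not_definable_isStandard hsat)
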